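/- Let $(M,g)$ be a smooth Riemannian manifold (without boundary) of dimension $m$ with Levi-Civita connection $\nabla$ and Ricci tensor $\operatorname{Ric}$. Let $X$ be a smooth vector field on $M$ (not necessarily the gradient of a function) and $\lambda\in\mathbb{R}$ a constant such that $$\operatorname{Ric}+\tfrac12\mathcal{L}_Xg=\lambda g ,$$ where $\mathcal{L}_Xg$ is the Lie derivative of the metric along $X$; that is, $(M,g,X)$ is a generic Ricci soliton. For a function $u$ write $\Delta u=\operatorname{div}\nabla u$ and $\Delta_Xu=\Delta u-g(X,\nabla u)$, let $|X|^2=g(X,X)$, and let $|\nabla X|$ be the Hilbert–Schmidt norm of $\nabla X$. Then, at every point of $M$, $$\tfrac12\Delta|X|^2=|\nabla X|^2-\operatorname{Ric}(X,X),$$ or equivalently $$\tfrac12\Delta_X|X|^2=|\nabla X|^2-\lambda|X|^2 .$$ -/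

import Mathlib

open Bundle FiberBundle VectorField
open scoped Manifold ContDiff

namespace RicciSoliton

noncomputable section

set_option linter.unusedSectionVars false

section

variable {E : Type*} [NormedAddCommGroup E] [NormedSpace ℝ E] [FiniteDimensional ℝ E]
  {H : Type*} [TopologicalSpace H] (I : ModelWithCorners ℝ E H)
  {M : Type*} [TopologicalSpace M] [ChartedSpace H M] [IsManifold I ∞ M]
  [RiemannianBundle (fun x : M ↦ TangentSpace I x)]
  [IsContMDiffRiemannianBundle I ∞ E (fun x : M ↦ TangentSpace I x)]

/-- The right-hand side `2 g(∇_X Y, Z)` of the Koszul formula, at the point `x`. -/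
def koszul (X Y Z : Π x : M, TangentSpace I x) (x : M) : ℝ :=
  d% (fun y ↦ inner ℝ (Y y) (Z y)) x (X x) + d% (fun y ↦ inner ℝ (Z y) (X y)) x (Y x)
    - d% (fun y ↦ inner ℝ (X y) (Y y)) x (Z x)
    + inner ℝ (mlieBracket I X Y x) (Z x) - inner ℝ (mlieBracket I Y Z x) (X x)
    + inner ℝ (mlieBracket I Z X x) (Y x)

variable {I}

theorem mdiff_inner {X Y : Π x : M, TangentSpace I x} {x : M}
    (hX : MDiffAt (T% X) x) (hY : MDiffAt (T% Y) x) :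
    MDiffAt (fun y ↦ (inner ℝ (X y) (Y y) : ℝ)) x :=
  MDifferentiableAt.inner_bundle (F := E) (E := fun x : M ↦ TangentSpace I x) hX hY

theorem koszul_tensorial_left {Y Z : Π x : M, TangentSpace I x} {x : M}
    (hY : MDiffAt (T% Y) x) (hZ : MDiffAt (T% Z) x) :
    TensorialAt I E (fun X ↦ koszul I X Y Z x) x where
  smul {f X} hf hX := by
    have : CompleteSpace E := FiniteDimensional.complete ℝ E
    simp [koszul, inner_smul_left, inner_smul_right, mvfderiv_fun_mul hf (mdiff_inner hX hY),
      mvfderiv_fun_mul hf (mdiff_inner hZ hX),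
      mlieBracket_smul_left hf hX, mlieBracket_smul_right hf hX, inner_add_left]
    simp only [real_inner_comm]
    ring
  add {X X'} hX hX' := by
    have : CompleteSpace E := FiniteDimensional.complete ℝ E
    simp [koszul, inner_add_left, inner_add_right,
      mvfderiv_fun_add (mdiff_inner hX hY) (mdiff_inner hX' hY),
      mvfderiv_fun_add (mdiff_inner hZ hX) (mdiff_inner hZ hX'),
      mlieBracket_add_left hX hX', mlieBracket_add_right hX hX']
    ring

theorem koszul_tensorial_right {X Y : Π x : M, TangentSpace I x} {x : M}
    (hX : MDiffAt (T% X) x) (hY : MDiffAt (T% Y) x) :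
    TensorialAt I E (fun Z ↦ koszul I X Y Z x) x where
  smul {f Z} hf hZ := by
    have : CompleteSpace E := FiniteDimensional.complete ℝ E
    simp [koszul, inner_smul_left, inner_smul_right, mvfderiv_fun_mul hf (mdiff_inner hY hZ),
      mvfderiv_fun_mul hf (mdiff_inner hZ hX),
      mlieBracket_smul_left hf hZ, mlieBracket_smul_right hf hZ, inner_add_left]
    simp only [real_inner_comm]
    ring
  add {Z Z'} hZ hZ' := by
    have : CompleteSpace E := FiniteDimensional.complete ℝ E
    simp [koszul, inner_add_left, inner_add_right,
      mvfderiv_fun_add (mdiff_inner hY hZ) (mdiff_inner hY hZ'),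
      mvfderiv_fun_add (mdiff_inner hZ hX) (mdiff_inner hZ' hX),
      mlieBracket_add_left hZ hZ', mlieBracket_add_right hZ hZ']
    ring

theorem koszul_add_mid {X Y Y' Z : Π x : M, TangentSpace I x} {x : M}
    (hX : MDiffAt (T% X) x) (hY : MDiffAt (T% Y) x) (hY' : MDiffAt (T% Y') x)
    (hZ : MDiffAt (T% Z) x) :
    koszul I X (Y + Y') Z x = koszul I X Y Z x + koszul I X Y' Z x := by
  have : CompleteSpace E := FiniteDimensional.complete ℝ E
  simp [koszul, inner_add_left, inner_add_right,
    mvfderiv_fun_add (mdiff_inner hY hZ) (mdiff_inner hY' hZ),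
    mvfderiv_fun_add (mdiff_inner hX hY) (mdiff_inner hX hY'),
    mlieBracket_add_left hY hY', mlieBracket_add_right hY hY']
  ring

theorem koszul_smul_mid {X Y Z : Π x : M, TangentSpace I x} {f : M → ℝ} {x : M}
    (hX : MDiffAt (T% X) x) (hY : MDiffAt (T% Y) x) (hZ : MDiffAt (T% Z) x) (hf : MDiffAt f x) :
    koszul I X (f • Y) Z x =
      f x * koszul I X Y Z x + 2 * (d% f x (X x) * inner ℝ (Y x) (Z x)) := by
  have : CompleteSpace E := FiniteDimensional.complete ℝ E
  simp [koszul, inner_smul_left, inner_smul_right, mvfderiv_fun_mul hf (mdiff_inner hY hZ),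
    mvfderiv_fun_mul hf (mdiff_inner hX hY),
    mlieBracket_smul_left hf hY, mlieBracket_smul_right hf hY, inner_add_left]
  simp only [real_inner_comm]
  ring

/-- The Levi-Civita covariant derivative `v ↦ ∇_v Y` of a vector field `Y` differentiable at `x`: the
linear map with `2 g(∇_v Y, w) = koszul v Y w`, written in an orthonormal basis of the tangent
space. -/
def leviCivitaAux (Y : Π x : M, TangentSpace I x) (x : M) (hY : MDiffAt (T% Y) x) :
    TangentSpace I x →L[ℝ] TangentSpace I x :=
  have : FiniteDimensional ℝ (TangentSpace I x) := inferInstanceAs (FiniteDimensional ℝ E)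
  let b := stdOrthonormalBasis ℝ (TangentSpace I x)
  ∑ i, ((1 / 2 : ℝ) • (TensorialAt.mkHom₂ (I := I) (F := E) (F' := E)
    (V := fun x : M ↦ TangentSpace I x) (V' := fun x : M ↦ TangentSpace I x)
    (fun X Z ↦ koszul I X Y Z x) x
    (fun _ hZ ↦ koszul_tensorial_left hY hZ) (fun _ hX ↦ koszul_tensorial_right hX hY)).flip
      (b i)).smulRight (b i)

theorem inner_leviCivitaAux {X Y Z : Π x : M, TangentSpace I x} {x : M}
    (hX : MDiffAt (T% X) x) (hY : MDiffAt (T% Y) x) (hZ : MDiffAt (T% Z) x) :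
    inner ℝ (leviCivitaAux Y x hY (X x)) (Z x) = 1 / 2 * koszul I X Y Z x := by
  have : FiniteDimensional ℝ (TangentSpace I x) := inferInstanceAs (FiniteDimensional ℝ E)
  set b := stdOrthonormalBasis ℝ (TangentSpace I x)
  set B := TensorialAt.mkHom₂ (I := I) (F := E) (F' := E)
    (V := fun x : M ↦ TangentSpace I x) (V' := fun x : M ↦ TangentSpace I x)
    (fun X Z ↦ koszul I X Y Z x) x
    (fun _ hZ ↦ koszul_tensorial_left hY hZ) (fun _ hX ↦ koszul_tensorial_right hX hY) with hB
  have key : B (X x) (Z x) = koszul I X Y Z x := TensorialAt.mkHom₂_apply _ _ hX hZ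
  have h1 : leviCivitaAux Y x hY (X x) = ∑ i, (1 / 2 * B (X x) (b i)) • b i := by
    simp [leviCivitaAux, b, B]
  rw [h1, ← key, sum_inner]
  conv_rhs => rw [← b.sum_repr' (Z x), map_sum, Finset.mul_sum]
  refine Finset.sum_congr rfl fun i _ ↦ ?_
  rw [real_inner_smul_left, map_smul, smul_eq_mul]
  ring

variable (I M) in
open Classical in
/-- The Levi-Civita connection of the Riemannian manifold `M`. -/
def leviCivita : CovariantDerivative I E (fun x : M ↦ TangentSpace I x) where
  toFun Y x := if hY : MDiffAt (T% Y) x then leviCivitaAux Y x hY else 0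
  isCovariantDerivativeOnUniv :=
    { add := by
        intro Y Y' x hY hY' _
        have hs : MDiffAt (T% (Y + Y')) x := mdifferentiableAt_add_section hY hY'
        rw [dif_pos hY, dif_pos hY', dif_pos hs]
        ext v
        refine ext_inner_right ℝ fun w ↦ ?_
        have hv := mdifferentiableAt_extend I E (V := fun x : M ↦ TangentSpace I x) v
        have hw := mdifferentiableAt_extend I E (V := fun x : M ↦ TangentSpace I x) w
        have e1 := inner_leviCivitaAux hv hY hw
        have e2 := inner_leviCivitaAux hv hY' hw
        have e3 := inner_leviCivitaAux hv hs hw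
        rw [koszul_add_mid hv hY hY' hw] at e3
        simp only [extend_apply_self] at e1 e2 e3
        rw [add_apply, inner_add_left, e1, e2, e3]
        ring
      leibniz := by
        intro Y f x hY hf _
        have hs : MDiffAt (T% (f • Y)) x := hf.smul_section hY
        rw [dif_pos hY, dif_pos hs]
        ext v
        refine ext_inner_right ℝ fun w ↦ ?_
        have hv := mdifferentiableAt_extend I E (V := fun x : M ↦ TangentSpace I x) v
        have hw := mdifferentiableAt_extend I E (V := fun x : M ↦ TangentSpace I x) w
        have e1 := inner_leviCivitaAux hv hY hw
        have e3 := inner_leviCivitaAux hv hs hw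
        rw [koszul_smul_mid hv hY hw hf] at e3
        simp only [extend_apply_self] at e1 e3
        rw [add_apply, inner_add_left, smul_apply,
          ContinuousLinearMap.smulRight_apply, real_inner_smul_left, real_inner_smul_left, e1, e3]
        ring }

/-- The Koszul formula. -/
theorem inner_leviCivita {X Y Z : Π x : M, TangentSpace I x} {x : M}
    (hX : MDiffAt (T% X) x) (hY : MDiffAt (T% Y) x) (hZ : MDiffAt (T% Z) x) :
    inner ℝ (leviCivita I M Y x (X x)) (Z x) = 1 / 2 * koszul I X Y Z x := by
  rw [← inner_leviCivitaAux hX hY hZ]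
  simp [leviCivita, hY]

/-- The Levi-Civita connection is torsion-free. -/
theorem leviCivita_torsion {X Y : Π x : M, TangentSpace I x} {x : M}
    (hX : MDiffAt (T% X) x) (hY : MDiffAt (T% Y) x) :
    leviCivita I M Y x (X x) - leviCivita I M X x (Y x) = mlieBracket I X Y x := by
  refine ext_inner_right ℝ fun w ↦ ?_
  have hw := mdifferentiableAt_extend I E (V := fun x : M ↦ TangentSpace I x) w
  have e1 := inner_leviCivita hX hY hw
  have e2 := inner_leviCivita hY hX hw
  simp only [extend_apply_self] at e1 e2
  rw [inner_sub_left, e1, e2]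
  simp only [koszul, mlieBracket_swap_apply (V := Y) (W := X),
    mlieBracket_swap_apply (V := extend E w) (W := X),
    mlieBracket_swap_apply (V := extend E w) (W := Y), real_inner_comm, extend_apply_self,
    inner_neg_left]
  ring

/-- The Levi-Civita connection is compatible with the metric. -/
theorem leviCivita_metric {X Y Z : Π x : M, TangentSpace I x} {x : M}
    (hX : MDiffAt (T% X) x) (hY : MDiffAt (T% Y) x) (hZ : MDiffAt (T% Z) x) :
    d% (fun y ↦ (inner ℝ (Y y) (Z y) : ℝ)) x (X x) =
      inner ℝ (leviCivita I M Y x (X x)) (Z x) + inner ℝ (Y x) (leviCivita I M Z x (X x)) := by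
  rw [real_inner_comm _ (Y x), inner_leviCivita hX hY hZ, inner_leviCivita hX hZ hY]
  simp only [koszul, mlieBracket_swap_apply (V := Z) (W := Y),
    mlieBracket_swap_apply (V := Z) (W := X),
    mlieBracket_swap_apply (V := Y) (W := X), real_inner_comm, inner_neg_left]
  ring

/-- The curvature `R(X, Y) Z = ∇_X ∇_Y Z - ∇_Y ∇_X Z - ∇_[X, Y] Z` of vector fields, at `x`. -/
def curvature (X Y Z : Π x : M, TangentSpace I x) (x : M) : TangentSpace I x :=
  leviCivita I M (fun y ↦ leviCivita I M Z y (Y y)) x (X x)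
    - leviCivita I M (fun y ↦ leviCivita I M Z y (X y)) x (Y x)
    - leviCivita I M Z x (mlieBracket I X Y x)

/-- The Riemann curvature tensor `R(u, v) w` at `x`. As the curvature is tensorial, it is computed
on locally smooth vector fields extending the tangent vectors `u`, `v`, `w`. -/
def riemann (x : M) (u v w : TangentSpace I x) : TangentSpace I x :=
  curvature (extend E u) (extend E v) (extend E w) x

/-- The Ricci tensor `Ric(v, w) = ∑ i, g(R(e_i, v) w, e_i)`, for an orthonormal basis `e_i` of the
tangent space at `x`. -/
def ricci (x : M) (v w : TangentSpace I x) : ℝ :=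
  have : FiniteDimensional ℝ (TangentSpace I x) := inferInstanceAs (FiniteDimensional ℝ E)
  ∑ i, inner ℝ (riemann x (stdOrthonormalBasis ℝ (TangentSpace I x) i) v w)
    (stdOrthonormalBasis ℝ (TangentSpace I x) i)

/-- The Lie derivative `(ℒ_X g)(Y, Z) = X (g(Y, Z)) - g([X, Y], Z) - g(Y, [X, Z])` of the metric,
on vector fields, at `x`. -/
def lieMetricField (X Y Z : Π x : M, TangentSpace I x) (x : M) : ℝ :=
  d% (fun y ↦ (inner ℝ (Y y) (Z y) : ℝ)) x (X x)
    - inner ℝ (mlieBracket I X Y x) (Z x) - inner ℝ (Y x) (mlieBracket I X Z x)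

/-- The Lie derivative `ℒ_X g` of the metric as a bilinear form on the tangent space at `x`. As
it is tensorial, it is computed on locally smooth vector fields extending the tangent vectors. -/
def lieMetric (X : Π x : M, TangentSpace I x) (x : M) (v w : TangentSpace I x) : ℝ :=
  lieMetricField X (extend E v) (extend E w) x

variable (I) in
/-- The gradient of a function: `g(∇u, v) = du(v)`. -/
def grad (u : M → ℝ) (x : M) : TangentSpace I x :=
  have : FiniteDimensional ℝ (TangentSpace I x) := inferInstanceAs (FiniteDimensional ℝ E)
  have : CompleteSpace (TangentSpace I x) := FiniteDimensional.complete ℝ _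
  (InnerProductSpace.toDual ℝ (TangentSpace I x)).symm (d% u x)

/-- The divergence of a vector field: the trace of `v ↦ ∇_v Y`. -/
def divergence (Y : Π x : M, TangentSpace I x) (x : M) : ℝ :=
  LinearMap.trace ℝ (TangentSpace I x) (leviCivita I M Y x : TangentSpace I x →ₗ[ℝ] TangentSpace I x)

variable (I) in
/-- The Laplace-Beltrami operator `Δu = div ∇u`. -/
def laplacian (u : M → ℝ) (x : M) : ℝ :=
  divergence (grad I u) x

/-- The `X`-Laplacian `Δ_X u = Δu - g(X, ∇u)`. -/
def laplacianX (X : Π x : M, TangentSpace I x) (u : M → ℝ) (x : M) : ℝ :=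
  laplacian I u x - inner ℝ (X x) (grad I u x)

/-- The squared (Hilbert-Schmidt) norm `|∇X|² = ∑ i, |∇_{e_i} X|²` of the covariant derivative, for
an orthonormal basis `e_i` of the tangent space at `x`. -/
def covDerivNormSq (X : Π x : M, TangentSpace I x) (x : M) : ℝ :=
  have : FiniteDimensional ℝ (TangentSpace I x) := inferInstanceAs (FiniteDimensional ℝ E)
  ∑ i, ‖leviCivita I M X x (stdOrthonormalBasis ℝ (TangentSpace I x) i)‖ ^ 2

/-- `(M, g, X)` is a Ricci soliton with soliton constant `lam`: the vector field `X` is smooth and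
`Ric + (1/2) ℒ_X g = lam g`. -/
structure IsRicciSoliton (X : Π x : M, TangentSpace I x) (lam : ℝ) : Prop where
  smooth : ContMDiff I I.tangent ∞ (fun x ↦ (⟨x, X x⟩ : TangentBundle I M))
  soliton : ∀ (x : M) (v w : TangentSpace I x),
    ricci x v w + 1 / 2 * lieMetric X x v w = lam * inner ℝ v w

end
end
end RicciSoliton

/-!
The proof computes with globally smooth vector fields. Since `M` is Hausdorff, bump functions extend
every tangent vector to such a field (`exists_contMDiff_extend`), and applying the Gram-Schmidt
process to a local frame gives smooth fields `F i` that are orthonormal near a given point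
(`exists_orthonormal_frame`). The Koszul formula then shows that `∇` preserves smoothness
(`contMDiff_nabla`), so that iterated covariant derivatives may be formed freely.

The Bochner formula `½ Δ |X|² = |∇X|² + g(ΔX, X)`, where `ΔX = ∑ i, ∇²_{e_i, e_i} X`, holds for
every smooth vector field (`half_laplacian_norm_sq`). The soliton equation enters in the identity
`ΔX = -Ric(X, ·)` (`IsRicciSoliton.sum_inner_nablaSq`). Indeed, differentiating the equation gives
`(∇_U Ric)(V, W) = -½ (g(∇²_{U, V} X, W) + g(V, ∇²_{U, W} X))` (`IsRicciSoliton.nablaRicci_eq`),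
and by the contracted second Bianchi identity
`∑ i, (∇_W Ric)(e_i, e_i) = 2 ∑ i, (∇_{e_i} Ric)(W, e_i)` (`sum_nablaRicci`)
one gets `g(ΔX, W) = ∑ i, g(∇²_{W, e_i} X - ∇²_{e_i, W} X, e_i)`, which is
`-Ric(W, X)` by the Ricci identity. The formula for `Δ_X` follows, because
`½ g(X, ∇|X|²) = g(∇_X X, X)` and the soliton equation on `(X, X)` reads
`Ric(X, X) + g(∇_X X, X) = λ |X|²`.

As `riemann` is evaluated on chosen local extensions of tangent vectors, the curvature must be known
to depend only on the values of the three fields at the point (`curvature_congr`); this is deduced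
from its skewness and pair symmetry.
-/

namespace RicciSoliton

open scoped Topology

noncomputable section

set_option linter.unusedSectionVars false

variable {E : Type*} [NormedAddCommGroup E] [NormedSpace ℝ E] [FiniteDimensional ℝ E]
  {H : Type*} [TopologicalSpace H] {I : ModelWithCorners ℝ E H}
  {M : Type*} [TopologicalSpace M] [ChartedSpace H M] [IsManifold I ∞ M]

/-! ### Smooth extensions -/

/-- A vector field smooth on a neighbourhood of `x` agrees near `x` with a globally smooth one. -/
theorem exists_contMDiff_eventuallyEq [T2Space M] {Y : Π x : M, TangentSpace I x} {x : M}
    {s : Set M} (hs : s ∈ 𝓝 x) (hY : CMDiff[s] ∞ (T% Y)) :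
    ∃ Z : Π x : M, TangentSpace I x, CMDiff ∞ (T% Z) ∧ ∀ᶠ y in 𝓝 x, Z y = Y y := by
  obtain ⟨u, hus, hu, hxu⟩ := mem_nhds_iff.1 hs
  obtain ⟨f, hf, -⟩ := (SmoothBumpFunction.nhds_basis_support (I := I) (hu.mem_nhds hxu)).mem_iff.1
    (hu.mem_nhds hxu)
  refine ⟨(f : M → ℝ) • Y, ContMDiffOn.smul_section_of_tsupport f.contMDiff.contMDiffOn hu hf
    (hY.mono hus), ?_⟩
  filter_upwards [f.eventuallyEq_one] with y hy
  simp [hy]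

/-- A tangent vector extends to a globally smooth vector field. -/
theorem exists_contMDiff_extend [T2Space M] {x : M} (v : TangentSpace I x) :
    ∃ Z : Π x : M, TangentSpace I x, CMDiff ∞ (T% Z) ∧ ∀ᶠ y in 𝓝 x, Z y = extend E v y := by
  obtain ⟨s, hs, h⟩ := exists_contMDiffOn_extend (k := ∞) I E (V := fun x : M ↦ TangentSpace I x) v
  exact exists_contMDiff_eventuallyEq hs h

theorem exists_contMDiff_eq [T2Space M] {x : M} (v : TangentSpace I x) :
    ∃ Z : Π x : M, TangentSpace I x, CMDiff ∞ (T% Z) ∧ Z x = v := by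
  obtain ⟨Z, hZ, h⟩ := exists_contMDiff_extend v
  exact ⟨Z, hZ, by simp [h.self_of_nhds]⟩

/-! ### Derivations and Lie brackets of smooth fields -/

theorem contMDiff_mvfderiv {f : M → ℝ} {Y : Π x : M, TangentSpace I x} (hf : CMDiff ∞ f)
    (hY : CMDiff ∞ (T% Y)) : CMDiff ∞ (fun y ↦ d% f y (Y y)) := by
  have h1 : ContMDiff I.tangent 𝓘(ℝ, ℝ).tangent ∞ (tangentMap I 𝓘(ℝ, ℝ) f) :=
    hf.contMDiff_tangentMap (by simp)
  exact (contMDiff_snd_tangentBundle_modelSpace (n := ∞) ℝ 𝓘(ℝ, ℝ)).comp (h1.comp hY)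

theorem contMDiff_mlieBracket {Y Z : Π x : M, TangentSpace I x} (hY : CMDiff ∞ (T% Y))
    (hZ : CMDiff ∞ (T% Z)) : CMDiff ∞ (T% (mlieBracket I Y Z)) := by
  have : CompleteSpace E := FiniteDimensional.complete ℝ E
  have : IsManifold I (minSmoothness ℝ 2) M := by simp; infer_instance
  have : IsManifold I ((⊤ : ℕ∞) + 1) M := inferInstanceAs (IsManifold I ∞ M)
  exact ContDiff.mlieBracket_vectorField (m := ⊤) (n := ⊤) hY hZ (by simp)

theorem mlieBracket_jacobi {X Y Z : Π x : M, TangentSpace I x} (hX : CMDiff ∞ (T% X))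
    (hY : CMDiff ∞ (T% Y)) (hZ : CMDiff ∞ (T% Z)) :
    mlieBracket I X (mlieBracket I Y Z) =
      mlieBracket I (mlieBracket I X Y) Z + mlieBracket I Y (mlieBracket I X Z) := by
  have : CompleteSpace E := FiniteDimensional.complete ℝ E
  have h : (minSmoothness ℝ 2) ≤ ∞ := by
    simpa using (mod_cast le_top : ((2 : ℕ∞) : WithTop ℕ∞) ≤ ∞)
  have : IsManifold I (minSmoothness ℝ 3) M := by simp; infer_instance
  exact leibniz_identity_mlieBracket (hX.of_le h) (hY.of_le h) (hZ.of_le h)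

theorem mdiffAt_field {Y : Π x : M, TangentSpace I x} (hY : CMDiff ∞ (T% Y)) (x : M) :
    MDiffAt (T% Y) x := hY.mdifferentiableAt (by simp)

theorem mdiffAt_fun {f : M → ℝ} (hf : CMDiff ∞ f) (x : M) :
    MDiffAt f x := hf.mdifferentiableAt (by simp)

theorem mvfderiv_congr {f g : M → ℝ} {x : M} (h : f =ᶠ[𝓝 x] g) : d% f x = d% g x := by
  ext v
  rw [mvfderiv, mvfderiv, h.mfderiv_eq]
  rfl

theorem mvfderiv_fun_const_mul {f : M → ℝ} (hf : CMDiff ∞ f) (a : ℝ) (x : M)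
    (v : TangentSpace I x) : d% (fun y ↦ a * f y) x v = a * d% f x v := by
  rw [mvfderiv_fun_mul mdifferentiableAt_const (mdiffAt_fun hf x), mvfderiv_const]
  simp

theorem mvfderiv_fun_sum {ι : Type*} [Fintype ι] {f : ι → M → ℝ} (hf : ∀ i, CMDiff ∞ (f i))
    (x : M) (v : TangentSpace I x) :
    d% (fun y ↦ ∑ i, f i y) x v = ∑ i, d% (f i) x v := by
  classical
  have h (s : Finset ι) : CMDiff ∞ (fun y ↦ ∑ i ∈ s, f i y) ∧
      d% (fun y ↦ ∑ i ∈ s, f i y) x v = ∑ i ∈ s, d% (f i) x v := by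
    induction s using Finset.induction_on with
    | empty => simpa [mvfderiv_const] using contMDiff_const
    | insert i s hi ih =>
      simp only [Finset.sum_insert hi]
      refine ⟨(hf i).add ih.1, ?_⟩
      rw [mvfderiv_fun_add (mdiffAt_fun (hf i) x) (mdiffAt_fun ih.1 x), add_apply, ih.2]
  exact (h Finset.univ).2

/-- The Lie bracket acts on functions as the commutator of derivations. Expanding the Jacobi
identity for `X`, `Y` and `f • Z` gives this identity multiplied by `Z`. -/
theorem mvfderiv_mlieBracket [T2Space M] {X Y : Π x : M, TangentSpace I x} {f : M → ℝ}
    (hX : CMDiff ∞ (T% X)) (hY : CMDiff ∞ (T% Y)) (hf : CMDiff ∞ f) (x : M) :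
    d% f x (mlieBracket I X Y x) =
      d% (fun y ↦ d% f y (Y y)) x (X x) - d% (fun y ↦ d% f y (X y)) x (Y x) := by
  have : CompleteSpace E := FiniteDimensional.complete ℝ E
  by_cases hE : ∀ v : TangentSpace I x, v = 0
  · rw [hE (X x), hE (Y x), hE (mlieBracket I X Y x)]; simp
  push Not at hE
  obtain ⟨v, hv⟩ := hE
  obtain ⟨Z, hZ, hZv⟩ := exists_contMDiff_extend v
  have hZx : Z x ≠ 0 := by rw [hZv.self_of_nhds]; simpa using hv
  have expand {W : Π x : M, TangentSpace I x} (W' : Π x : M, TangentSpace I x)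
      {g : M → ℝ} (hg : CMDiff ∞ g) (hW : CMDiff ∞ (T% W)) : mlieBracket I W' (g • W) =
        (fun y ↦ d% g y (W' y)) • W + g • mlieBracket I W' W := by
    ext y
    rw [mlieBracket_smul_right (mdiffAt_fun hg y) (mdiffAt_field hW y)]; rfl
  have hXf := contMDiff_mvfderiv hf hX
  have hYf := contMDiff_mvfderiv hf hY
  have add {W W₁ : Π x : M, TangentSpace I x} (W' : Π x : M, TangentSpace I x)
      (hW : CMDiff ∞ (T% W)) (hW₁ : CMDiff ∞ (T% W₁)) : mlieBracket I W' (W + W₁) =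
        mlieBracket I W' W + mlieBracket I W' W₁ := by
    ext y
    rw [mlieBracket_add_right (mdiffAt_field hW y) (mdiffAt_field hW₁ y)]; rfl
  have key := congrFun (mlieBracket_jacobi hX hY (hf.smul_section hZ)) x
  rw [expand Y hf hZ, expand X hf hZ, add X (hYf.smul_section hZ)
      (hf.smul_section (contMDiff_mlieBracket hY hZ)),
    add Y (hXf.smul_section hZ) (hf.smul_section (contMDiff_mlieBracket hX hZ)),
    expand X hYf hZ, expand Y hXf hZ, expand X hf (contMDiff_mlieBracket hY hZ),
    expand Y hf (contMDiff_mlieBracket hX hZ), expand _ hf hZ, mlieBracket_jacobi hX hY hZ] at key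
  simp only [Pi.add_apply, Pi.smul_apply', smul_add] at key
  have h2 : (d% f x (mlieBracket I X Y x) -
      (d% (fun y ↦ d% f y (Y y)) x (X x) - d% (fun y ↦ d% f y (X y)) x (Y x))) • Z x = 0 := by
    rw [sub_smul, sub_smul, ← sub_eq_zero.2 key.symm]
    module
  exact sub_eq_zero.1 ((smul_eq_zero.1 h2).resolve_right hZx)

/-! ### Orthonormal frames and smoothness of the Levi-Civita connection -/

variable [RiemannianBundle (fun x : M ↦ TangentSpace I x)]
  [IsContMDiffRiemannianBundle I ∞ E (fun x : M ↦ TangentSpace I x)]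

theorem contMDiff_inner {Y Z : Π x : M, TangentSpace I x} (hY : CMDiff ∞ (T% Y))
    (hZ : CMDiff ∞ (T% Z)) : CMDiff ∞ (fun y ↦ (inner ℝ (Y y) (Z y) : ℝ)) :=
  ContMDiff.inner_bundle (F := E) (E := fun x : M ↦ TangentSpace I x) hY hZ

theorem contMDiffOn_inner {Y Z : Π x : M, TangentSpace I x} {s : Set M} (hY : CMDiff[s] ∞ (T% Y))
    (hZ : CMDiff[s] ∞ (T% Z)) : CMDiff[s] ∞ (fun y ↦ (inner ℝ (Y y) (Z y) : ℝ)) :=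
  ContMDiffOn.inner_bundle (F := E) (E := fun x : M ↦ TangentSpace I x) hY hZ

theorem contMDiffOn_gramSchmidt {n : ℕ} {C : Fin n → Π x : M, TangentSpace I x} {s : Set M}
    (hC : ∀ i, CMDiff[s] ∞ (T% (C i))) (hli : ∀ y ∈ s, LinearIndependent ℝ (C · y)) (i : Fin n) :
    CMDiff[s] ∞ (T% (fun y ↦ InnerProductSpace.gramSchmidt ℝ (C · y) i)) := by
  induction i using WellFoundedLT.induction with
  | ind i ih =>
  have h1 : CMDiff[s] ∞ (T% (fun y ↦ C i y - ∑ j ∈ Finset.Iio i,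
      ((inner ℝ (InnerProductSpace.gramSchmidt ℝ (C · y) j) (C i y) : ℝ) /
        (inner ℝ (InnerProductSpace.gramSchmidt ℝ (C · y) j)
          (InnerProductSpace.gramSchmidt ℝ (C · y) j) : ℝ)) •
        InnerProductSpace.gramSchmidt ℝ (C · y) j)) := by
    refine (hC i).sub_section (.sum_section fun j hj ↦ ?_)
    have hj := ih j (Finset.mem_Iio.1 hj)
    refine ContMDiffOn.smul_section ((contMDiffOn_inner hj (hC i)).div₀ (contMDiffOn_inner hj hj)
      fun y hy ↦ ?_) hj
    simpa using InnerProductSpace.gramSchmidt_ne_zero j (hli y hy)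
  convert h1 using 3 with y
  rw [eq_sub_iff_add_eq]
  refine Eq.trans ?_ (InnerProductSpace.gramSchmidt_def'' ℝ (C · y) i).symm
  simp

/-- Near each point there is an orthonormal frame of smooth vector fields. -/
theorem exists_orthonormal_frame [T2Space M] (x : M) :
    ∃ F : Fin (Module.finrank ℝ E) → Π x : M, TangentSpace I x, (∀ i, CMDiff ∞ (T% (F i))) ∧
      ∀ᶠ y in 𝓝 x, Orthonormal ℝ (F · y) := by
  set e := trivializationAt E (fun x : M ↦ TangentSpace I x) x
  have hs : e.baseSet ∈ 𝓝 x := e.open_baseSet.mem_nhds (mem_baseSet_trivializationAt' x)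
  have hloc := e.isLocalFrameOn_localFrame_baseSet I ∞ (Module.finBasis ℝ E)
  set C := e.localFrame (Module.finBasis ℝ E)
  have hli : ∀ y ∈ e.baseSet, LinearIndependent ℝ (C · y) := fun y hy ↦ hloc.linearIndependent hy
  have hG := contMDiffOn_gramSchmidt hloc.contMDiffOn hli
  have hN (i) : CMDiff[e.baseSet] ∞
      (T% (fun y ↦ InnerProductSpace.gramSchmidtNormed ℝ (C · y) i)) := by
    have h1 : CMDiff[e.baseSet] ∞ (fun y ↦ (√(inner ℝ (InnerProductSpace.gramSchmidt ℝ (C · y) i)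
        (InnerProductSpace.gramSchmidt ℝ (C · y) i)))⁻¹) := by
      intro y hy
      have h0 := InnerProductSpace.gramSchmidt_ne_zero i (hli y hy)
      have h2 : (inner ℝ (InnerProductSpace.gramSchmidt ℝ (C · y) i)
        (InnerProductSpace.gramSchmidt ℝ (C · y) i) : ℝ) ≠ 0 := by simpa using h0
      refine ContMDiffWithinAt.inv₀ ?_ (by rwa [← norm_eq_sqrt_real_inner, norm_ne_zero_iff])
      exact (Real.contDiffAt_sqrt h2).contMDiffAt.comp_contMDiffWithinAt y
        (contMDiffOn_inner (hG i) (hG i) y hy)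
    have h3 := h1.smul_section (hG i)
    convert h3 using 3 with y
    rw [InnerProductSpace.gramSchmidtNormed, norm_eq_sqrt_real_inner]
    rfl
  choose F hF hFe using fun i ↦ exists_contMDiff_eventuallyEq hs (hN i)
  refine ⟨F, hF, ?_⟩
  filter_upwards [Filter.eventually_all.2 hFe, hs] with y hy hys
  simp only [hy]
  exact InnerProductSpace.gramSchmidtNormed_orthonormal (hli y hys)

/-- An orthonormal family of the right cardinality in a tangent space, as a basis. -/
def orthonormalBasisOfFrame {x : M} {v : Fin (Module.finrank ℝ E) → TangentSpace I x}
    (hv : Orthonormal ℝ v) : OrthonormalBasis (Fin (Module.finrank ℝ E)) ℝ (TangentSpace I x) :=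
  have : FiniteDimensional ℝ (TangentSpace I x) := inferInstanceAs (FiniteDimensional ℝ E)
  OrthonormalBasis.mk hv
    (hv.linearIndependent.span_eq_top_of_card_eq_finrank' (by simp; rfl)).ge

@[simp]
theorem orthonormalBasisOfFrame_apply {x : M} {v : Fin (Module.finrank ℝ E) → TangentSpace I x}
    (hv : Orthonormal ℝ v) (i) : orthonormalBasisOfFrame hv i = v i := by
  simp [orthonormalBasisOfFrame]

/-- A vector field is smooth if its inner products with all smooth vector fields are smooth. -/
theorem contMDiff_of_inner [T2Space M] {Y : Π x : M, TangentSpace I x}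
    (hY : ∀ Z : Π x : M, TangentSpace I x, CMDiff ∞ (T% Z) →
      CMDiff ∞ (fun y ↦ (inner ℝ (Z y) (Y y) : ℝ))) : CMDiff ∞ (T% Y) := by
  intro x
  obtain ⟨F, hF, ho⟩ := exists_orthonormal_frame (I := I) x
  have h1 : CMDiff ∞ (T% (fun y ↦ ∑ i, (inner ℝ (F i y) (Y y) : ℝ) • F i y)) :=
    .sum_section fun i _ ↦ (hY _ (hF i)).smul_section (hF i)
  refine (h1 x).congr_of_eventuallyEq ?_
  filter_upwards [ho] with y hy
  have := (orthonormalBasisOfFrame hy).sum_repr' (Y y)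
  simp only [orthonormalBasisOfFrame_apply] at this
  simp [this]

theorem contMDiff_koszul {X Y Z : Π x : M, TangentSpace I x} (hX : CMDiff ∞ (T% X))
    (hY : CMDiff ∞ (T% Y)) (hZ : CMDiff ∞ (T% Z)) : CMDiff ∞ (koszul I X Y Z) := by
  have a1 := contMDiff_mvfderiv (contMDiff_inner hY hZ) hX
  have a2 := contMDiff_mvfderiv (contMDiff_inner hZ hX) hY
  have a3 := contMDiff_mvfderiv (contMDiff_inner hX hY) hZ
  have b1 := contMDiff_inner (contMDiff_mlieBracket hX hY) hZ
  have b2 := contMDiff_inner (contMDiff_mlieBracket hY hZ) hX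
  have b3 := contMDiff_inner (contMDiff_mlieBracket hZ hX) hY
  exact ((((a1.add a2).sub a3).add b1).sub b2).add b3

/-- The covariant derivative `∇_X Y` of vector fields. -/
def nabla (X Y : Π x : M, TangentSpace I x) (x : M) : TangentSpace I x :=
  leviCivita I M Y x (X x)

/-- By the Koszul formula, `∇_X Y` is smooth for smooth `X` and `Y`. -/
theorem contMDiff_nabla [T2Space M] {X Y : Π x : M, TangentSpace I x} (hX : CMDiff ∞ (T% X))
    (hY : CMDiff ∞ (T% Y)) : CMDiff ∞ (T% (nabla X Y)) := by
  refine contMDiff_of_inner fun Z hZ ↦ ?_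
  have h1 : (fun y ↦ (inner ℝ (Z y) (nabla X Y y) : ℝ)) = fun y ↦ 1 / 2 * koszul I X Y Z y := by
    ext y
    rw [real_inner_comm, ← inner_leviCivita (mdiffAt_field hX y) (mdiffAt_field hY y)
      (mdiffAt_field hZ y)]
    rfl
  rw [h1]
  exact contMDiff_const.mul (contMDiff_koszul hX hY hZ)

theorem inner_grad (u : M → ℝ) (x : M) (v : TangentSpace I x) :
    inner ℝ (grad I u x) v = d% u x v := by
  have : FiniteDimensional ℝ (TangentSpace I x) := inferInstanceAs (FiniteDimensional ℝ E)
  have : CompleteSpace (TangentSpace I x) := FiniteDimensional.complete ℝ _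
  exact InnerProductSpace.toDual_symm_apply

theorem contMDiff_grad [T2Space M] {u : M → ℝ} (hu : CMDiff ∞ u) :
    CMDiff ∞ (T% (grad I u)) := by
  refine contMDiff_of_inner fun Z hZ ↦ ?_
  simp only [real_inner_comm (grad I u _), inner_grad]
  exact contMDiff_mvfderiv hu hZ

/-! ### Calculus of the Levi-Civita connection -/

theorem nabla_add_left (X X' Y : Π x : M, TangentSpace I x) :
    nabla (X + X') Y = nabla X Y + nabla X' Y := by
  ext x; simp [nabla]

theorem nabla_neg_left (X Y : Π x : M, TangentSpace I x) : nabla (-X) Y = -nabla X Y := by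
  ext x; simp [nabla]

theorem nabla_sub_left (X X' Y : Π x : M, TangentSpace I x) :
    nabla (X - X') Y = nabla X Y - nabla X' Y := by
  ext x; simp [nabla]

theorem nabla_add_right {Y Y' : Π x : M, TangentSpace I x} (X : Π x : M, TangentSpace I x)
    (hY : CMDiff ∞ (T% Y)) (hY' : CMDiff ∞ (T% Y')) :
    nabla X (Y + Y') = nabla X Y + nabla X Y' := by
  ext x
  simp [nabla, (leviCivita I M).isCovariantDerivativeOnUniv.add (mdiffAt_field hY x)
    (mdiffAt_field hY' x)]

theorem nabla_sub_right {Y Y' : Π x : M, TangentSpace I x} (X : Π x : M, TangentSpace I x)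
    (hY : CMDiff ∞ (T% Y)) (hY' : CMDiff ∞ (T% Y')) :
    nabla X (Y - Y') = nabla X Y - nabla X Y' := by
  rw [eq_sub_iff_add_eq, ← nabla_add_right X (hY.sub_section hY') hY', sub_add_cancel]

theorem nabla_sub_nabla {X Y : Π x : M, TangentSpace I x} (hX : CMDiff ∞ (T% X))
    (hY : CMDiff ∞ (T% Y)) : nabla X Y - nabla Y X = mlieBracket I X Y := by
  ext x
  exact leviCivita_torsion (mdiffAt_field hX x) (mdiffAt_field hY x)

theorem mvfderiv_inner {Y Z : Π x : M, TangentSpace I x} (X : Π x : M, TangentSpace I x)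
    (hY : CMDiff ∞ (T% Y)) (hZ : CMDiff ∞ (T% Z)) (x : M) :
    d% (fun y ↦ (inner ℝ (Y y) (Z y) : ℝ)) x (X x) =
      inner ℝ (nabla X Y x) (Z x) + inner ℝ (Y x) (nabla X Z x) := by
  have h := leviCivita_metric (mdifferentiableAt_extend I E (V := fun x : M ↦ TangentSpace I x)
    (X x)) (mdiffAt_field hY x) (mdiffAt_field hZ x)
  simpa [nabla] using h

/-! ### Symmetries and tensoriality of the curvature -/

theorem curvature_eq (X Y Z : Π x : M, TangentSpace I x) :
    curvature X Y Z = nabla X (nabla Y Z) - nabla Y (nabla X Z) - nabla (mlieBracket I X Y) Z :=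
  rfl

theorem contMDiff_curvature [T2Space M] {X Y Z : Π x : M, TangentSpace I x}
    (hX : CMDiff ∞ (T% X)) (hY : CMDiff ∞ (T% Y)) (hZ : CMDiff ∞ (T% Z)) :
    CMDiff ∞ (T% (curvature X Y Z)) :=
  ((contMDiff_nabla hX (contMDiff_nabla hY hZ)).sub_section
    (contMDiff_nabla hY (contMDiff_nabla hX hZ))).sub_section
      (contMDiff_nabla (contMDiff_mlieBracket hX hY) hZ)

theorem curvature_swap (X Y Z : Π x : M, TangentSpace I x) :
    curvature X Y Z = -curvature Y X Z := by
  rw [curvature_eq, curvature_eq, mlieBracket_swap, nabla_neg_left]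
  abel

theorem curvature_add_left [T2Space M] {X X' Y Z : Π x : M, TangentSpace I x}
    (hX : CMDiff ∞ (T% X)) (hX' : CMDiff ∞ (T% X')) (hZ : CMDiff ∞ (T% Z)) :
    curvature (X + X') Y Z = curvature X Y Z + curvature X' Y Z := by
  have h : mlieBracket I (X + X') Y = mlieBracket I X Y + mlieBracket I X' Y := by
    ext x
    exact mlieBracket_add_left (mdiffAt_field hX x) (mdiffAt_field hX' x)
  simp only [curvature_eq, nabla_add_left, h,
    nabla_add_right Y (contMDiff_nabla hX hZ) (contMDiff_nabla hX' hZ)]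
  abel

theorem curvature_sub_left [T2Space M] {X X' Y Z : Π x : M, TangentSpace I x}
    (hX : CMDiff ∞ (T% X)) (hX' : CMDiff ∞ (T% X')) (hZ : CMDiff ∞ (T% Z)) :
    curvature (X - X') Y Z = curvature X Y Z - curvature X' Y Z := by
  rw [eq_sub_iff_add_eq, ← curvature_add_left (hX.sub_section hX') hX' hZ, sub_add_cancel]

/-- The first Bianchi identity. -/
theorem curvature_bianchi_first [T2Space M] {X Y Z : Π x : M, TangentSpace I x}
    (hX : CMDiff ∞ (T% X)) (hY : CMDiff ∞ (T% Y)) (hZ : CMDiff ∞ (T% Z)) :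
    curvature X Y Z + curvature Y Z X + curvature Z X Y = 0 := by
  have e {A B C : Π x : M, TangentSpace I x} (hA : CMDiff ∞ (T% A)) (hB : CMDiff ∞ (T% B))
      (hC : CMDiff ∞ (T% C)) : mlieBracket I A (mlieBracket I B C) =
        nabla A (nabla B C) - nabla A (nabla C B) - nabla (mlieBracket I B C) A := by
    rw [← nabla_sub_nabla hA (contMDiff_mlieBracket hB hC), ← nabla_sub_nabla hB hC,
      nabla_sub_right A (contMDiff_nabla hB hC) (contMDiff_nabla hC hB)]
  have j := mlieBracket_jacobi hX hY hZ
  have s : mlieBracket I (mlieBracket I X Y) Z = -mlieBracket I Z (mlieBracket I X Y) :=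
    mlieBracket_swap
  have s' : mlieBracket I Z X = -mlieBracket I X Z := mlieBracket_swap
  rw [s, e hX hY hZ, e hZ hX hY, e hY hX hZ] at j
  rw [curvature_eq, curvature_eq, curvature_eq, s', nabla_neg_left, ← sub_eq_zero.2 j]
  abel

/-- The covariant derivatives along the Levi-Civita connection are skew with respect to the metric
up to a derivation, and the curvature, a commutator of such, is skew. -/
theorem inner_curvature_skew [T2Space M] {X Y Z W : Π x : M, TangentSpace I x}
    (hX : CMDiff ∞ (T% X)) (hY : CMDiff ∞ (T% Y)) (hZ : CMDiff ∞ (T% Z)) (hW : CMDiff ∞ (T% W))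
    (x : M) : inner ℝ (curvature X Y Z x) (W x) = -(inner ℝ (curvature X Y W x) (Z x) : ℝ) := by
  have h2 {A B : Π x : M, TangentSpace I x} (hA : CMDiff ∞ (T% A)) (hB : CMDiff ∞ (T% B)) :
      d% (fun y ↦ d% (fun z ↦ (inner ℝ (Z z) (W z) : ℝ)) y (B y)) x (A x) =
        inner ℝ (nabla A (nabla B Z) x) (W x) + inner ℝ (nabla B Z x) (nabla A W x)
        + (inner ℝ (nabla A Z x) (nabla B W x) + inner ℝ (Z x) (nabla A (nabla B W) x)) := by
    rw [funext (mvfderiv_inner B hZ hW), mvfderiv_fun_add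
      (mdiffAt_fun (contMDiff_inner (contMDiff_nabla hB hZ) hW) x)
      (mdiffAt_fun (contMDiff_inner hZ (contMDiff_nabla hB hW)) x), add_apply,
      mvfderiv_inner A (contMDiff_nabla hB hZ) hW, mvfderiv_inner A hZ (contMDiff_nabla hB hW)]
  have key := mvfderiv_mlieBracket hX hY (contMDiff_inner hZ hW) x
  rw [h2 hX hY, h2 hY hX, mvfderiv_inner _ hZ hW] at key
  simp only [curvature_eq, Pi.sub_apply, inner_sub_left]
  simp only [real_inner_comm (Z x)] at key ⊢
  linarith

/-- The pair symmetry `R(X, Y, Z, W) = R(Z, W, X, Y)`, a consequence of the first Bianchi identity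
and the skewness in each pair. -/
theorem inner_curvature_pair_symm [T2Space M] {X Y Z W : Π x : M, TangentSpace I x}
    (hX : CMDiff ∞ (T% X)) (hY : CMDiff ∞ (T% Y)) (hZ : CMDiff ∞ (T% Z)) (hW : CMDiff ∞ (T% W))
    (x : M) : inner ℝ (curvature X Y Z x) (W x) = (inner ℝ (curvature Z W X x) (Y x) : ℝ) := by
  have b {A B C : Π x : M, TangentSpace I x} (D : Π x : M, TangentSpace I x)
      (hA : CMDiff ∞ (T% A)) (hB : CMDiff ∞ (T% B)) (hC : CMDiff ∞ (T% C)) :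
      (inner ℝ (curvature A B C x) (D x) : ℝ) + inner ℝ (curvature B C A x) (D x)
        + inner ℝ (curvature C A B x) (D x) = 0 := by
    rw [← inner_add_left, ← inner_add_left]
    have := congrFun (curvature_bianchi_first hA hB hC) x
    simp only [Pi.add_apply, Pi.zero_apply] at this
    rw [this, inner_zero_left]
  have s (A B C D : Π x : M, TangentSpace I x) :
      (inner ℝ (curvature A B C x) (D x) : ℝ) = -inner ℝ (curvature B A C x) (D x) := by
    rw [curvature_swap, Pi.neg_apply, inner_neg_left]
  have t {A B C D : Π x : M, TangentSpace I x} (hA : CMDiff ∞ (T% A)) (hB : CMDiff ∞ (T% B))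
    (hC : CMDiff ∞ (T% C)) (hD : CMDiff ∞ (T% D)) := inner_curvature_skew hA hB hC hD x
  -- `b` is the Bianchi identity for each choice of three fields among `X`, `Y`, `Z`, `W`; the
  -- signed sum of the four, reduced by skewness in each pair, is twice the claim
  linarith [b W hX hY hZ, b X hY hZ hW, b Y hZ hW hX, b Z hW hX hY, t hX hY hZ hW, t hW hX hY hZ,
    t hZ hW hX hY, s Y W Z X, s X Z W Y, t hY hZ hW hX, t hY hW hZ hX, t hZ hX hW hY]

/-- The curvature at a point depends only on the values there of the three fields. For the third
field this follows from skewness, and the pair symmetry transports it to the other two. -/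
theorem curvature_congr [T2Space M] {X Y Z X' Y' Z' : Π x : M, TangentSpace I x} {x : M}
    (hX : CMDiff ∞ (T% X)) (hY : CMDiff ∞ (T% Y)) (hZ : CMDiff ∞ (T% Z))
    (hX' : CMDiff ∞ (T% X')) (hY' : CMDiff ∞ (T% Y')) (hZ' : CMDiff ∞ (T% Z'))
    (eX : X x = X' x) (eY : Y x = Y' x) (eZ : Z x = Z' x) :
    curvature X Y Z x = curvature X' Y' Z' x := by
  have right {A B C D : Π x : M, TangentSpace I x} (hA : CMDiff ∞ (T% A)) (hB : CMDiff ∞ (T% B))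
      (hC : CMDiff ∞ (T% C)) (hD : CMDiff ∞ (T% D)) (h : C x = D x) :
      curvature A B C x = curvature A B D x := by
    refine ext_inner_right ℝ fun w ↦ ?_
    obtain ⟨W, hW, hWw⟩ := exists_contMDiff_extend w
    have hWx : W x = w := by rw [hWw.self_of_nhds]; simp
    rw [← hWx, inner_curvature_skew hA hB hC hW, inner_curvature_skew hA hB hD hW, h]
  have left {A B C D : Π x : M, TangentSpace I x} (hA : CMDiff ∞ (T% A)) (hB : CMDiff ∞ (T% B))
      (hC : CMDiff ∞ (T% C)) (hD : CMDiff ∞ (T% D)) (h : A x = D x) :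
      curvature A B C x = curvature D B C x := by
    refine ext_inner_right ℝ fun w ↦ ?_
    obtain ⟨W, hW, hWw⟩ := exists_contMDiff_extend w
    have hWx : W x = w := by rw [hWw.self_of_nhds]; simp
    rw [← hWx, inner_curvature_pair_symm hA hB hC hW, inner_curvature_pair_symm hD hB hC hW,
      right hC hW hA hD h]
  rw [right hX hY hZ hZ' eZ, left hX hY hZ' hX' eX, curvature_swap, Pi.neg_apply,
    left hY hX' hZ' hY' eY, curvature_swap X' Y', Pi.neg_apply]

/-- The Levi-Civita connection is local, also at points where the field is not differentiable and
the connection takes the value `0`. -/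
theorem leviCivita_congr [T2Space M] {Y Y' : Π x : M, TangentSpace I x} {x : M}
    (h : ∀ᶠ y in 𝓝 x, Y y = Y' y) : leviCivita I M Y x = leviCivita I M Y' x := by
  have e : (T% Y) =ᶠ[𝓝 x] (T% Y') := h.mono fun y hy ↦ by simp [hy]
  by_cases hY : MDiffAt (T% Y) x
  · exact (leviCivita I M).isCovariantDerivativeOnUniv.congr_of_eventuallyEq hY
      (hY.congr_of_eventuallyEq e.symm) Filter.univ_mem h
  · have hY' : ¬ MDiffAt (T% Y') x := fun h ↦ hY (h.congr_of_eventuallyEq e)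
    simp [leviCivita, hY, hY']

theorem curvature_congr_of_eventuallyEq [T2Space M] {X Y Z X' Y' Z' : Π x : M, TangentSpace I x}
    {x : M} (hX : ∀ᶠ y in 𝓝 x, X y = X' y) (hY : ∀ᶠ y in 𝓝 x, Y y = Y' y)
    (hZ : ∀ᶠ y in 𝓝 x, Z y = Z' y) : curvature X Y Z x = curvature X' Y' Z' x := by
  have h {A A' : Π x : M, TangentSpace I x} (hA : ∀ᶠ y in 𝓝 x, A y = A' y) :
      leviCivita I M (fun y ↦ leviCivita I M Z y (A y)) x =
        leviCivita I M (fun y ↦ leviCivita I M Z' y (A' y)) x := by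
    refine leviCivita_congr ?_
    filter_upwards [hA, eventually_eventually_nhds.2 hZ] with y h1 h2
    rw [h1, leviCivita_congr h2]
  have hb : mlieBracket I X Y x = mlieBracket I X' Y' x :=
    Filter.EventuallyEq.mlieBracket_vectorField_eq hX hY
  rw [curvature, curvature, h hX, h hY, hb, hX.self_of_nhds, hY.self_of_nhds, leviCivita_congr hZ]

theorem riemann_apply [T2Space M] {X Y Z : Π x : M, TangentSpace I x} (hX : CMDiff ∞ (T% X))
    (hY : CMDiff ∞ (T% Y)) (hZ : CMDiff ∞ (T% Z)) (x : M) :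
    riemann x (X x) (Y x) (Z x) = curvature X Y Z x := by
  obtain ⟨A, hA, hAe⟩ := exists_contMDiff_extend (X x)
  obtain ⟨B, hB, hBe⟩ := exists_contMDiff_extend (Y x)
  obtain ⟨C, hC, hCe⟩ := exists_contMDiff_extend (Z x)
  rw [riemann, ← curvature_congr_of_eventuallyEq hAe hBe hCe]
  exact curvature_congr hA hB hC hX hY hZ (by simp [hAe.self_of_nhds])
    (by simp [hBe.self_of_nhds]) (by simp [hCe.self_of_nhds])

/-! ### The Ricci tensor as a trace -/

/-- The endomorphism `u ↦ R(u, v) w`, of which the Ricci tensor is the trace. -/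
def riemannHom [T2Space M] {x : M} (v w : TangentSpace I x) :
    TangentSpace I x →ₗ[ℝ] TangentSpace I x where
  toFun u := riemann x u v w
  map_add' u u' := by
    obtain ⟨U, hU, rfl⟩ := exists_contMDiff_eq u
    obtain ⟨U', hU', rfl⟩ := exists_contMDiff_eq u'
    obtain ⟨V, hV, rfl⟩ := exists_contMDiff_eq v
    obtain ⟨W, hW, rfl⟩ := exists_contMDiff_eq w
    rw [← Pi.add_apply U U', riemann_apply (hU.add_section hU') hV hW, riemann_apply hU hV hW,
      riemann_apply hU' hV hW, curvature_add_left hU hU' hW, Pi.add_apply]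
  map_smul' c u := by
    obtain ⟨U, hU, rfl⟩ := exists_contMDiff_eq u
    obtain ⟨V, hV, rfl⟩ := exists_contMDiff_eq v
    obtain ⟨W, hW, rfl⟩ := exists_contMDiff_eq w
    refine ext_inner_right ℝ fun z ↦ ?_
    obtain ⟨Z, hZ, rfl⟩ := exists_contMDiff_eq z
    have hc : CMDiff ∞ (T% (c • U)) := hU.const_smul_section
    rw [← Pi.smul_apply c U, riemann_apply hc hV hW, riemann_apply hU hV hW,
      inner_curvature_pair_symm hc hV hW hZ, inner_curvature_skew hW hZ hc hV, Pi.smul_apply,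
      inner_smul_right, RingHom.id_apply, inner_smul_left, inner_curvature_pair_symm hU hV hW hZ,
      inner_curvature_skew hW hZ hU hV]
    simp

@[simp]
theorem riemannHom_apply [T2Space M] {x : M} (u v w : TangentSpace I x) :
    riemannHom v w u = riemann x u v w := rfl

theorem ricci_eq_sum [T2Space M] {ι : Type*} [Fintype ι] {x : M}
    (b : OrthonormalBasis ι ℝ (TangentSpace I x)) (v w : TangentSpace I x) :
    ricci x v w = ∑ i, inner ℝ (riemann x (b i) v w) (b i) := by
  have : FiniteDimensional ℝ (TangentSpace I x) := inferInstanceAs (FiniteDimensional ℝ E)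
  have h1 := LinearMap.trace_eq_sum_inner (riemannHom v w) b
  rw [LinearMap.trace_eq_sum_inner (riemannHom v w) (stdOrthonormalBasis ℝ (TangentSpace I x))]
    at h1
  simpa only [ricci, real_inner_comm, riemannHom_apply] using h1

theorem ricci_eq_sum_frame [T2Space M] {F : Fin (Module.finrank ℝ E) → Π x : M, TangentSpace I x}
    (hF : ∀ i, CMDiff ∞ (T% (F i))) {V W : Π x : M, TangentSpace I x} (hV : CMDiff ∞ (T% V))
    (hW : CMDiff ∞ (T% W)) {x : M} (ho : Orthonormal ℝ (F · x)) :
    ricci x (V x) (W x) = ∑ i, inner ℝ (curvature (F i) V W x) (F i x) := by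
  simp [ricci_eq_sum (orthonormalBasisOfFrame ho), riemann_apply (hF _) hV hW]

/-! ### The second Bianchi identity and its contraction -/

/-- The covariant derivative `(∇_U R)(X, Y) Z` of the curvature tensor, on vector fields. -/
def nablaCurvature (U X Y Z : Π x : M, TangentSpace I x) : Π x : M, TangentSpace I x :=
  nabla U (curvature X Y Z) - curvature (nabla U X) Y Z - curvature X (nabla U Y) Z
    - curvature X Y (nabla U Z)

theorem nablaCurvature_swap [T2Space M] {U X Y Z : Π x : M, TangentSpace I x}
    (hX : CMDiff ∞ (T% X)) (hY : CMDiff ∞ (T% Y)) (hZ : CMDiff ∞ (T% Z)) :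
    nablaCurvature U X Y Z = -nablaCurvature U Y X Z := by
  have h : nabla U (curvature X Y Z) + nabla U (curvature Y X Z) = 0 := by
    rw [← nabla_add_right U (contMDiff_curvature hX hY hZ) (contMDiff_curvature hY hX hZ),
      curvature_swap X Y, neg_add_cancel]
    exact congrArg (fun A x ↦ A x (U x)) (leviCivita I M).zero
  rw [nablaCurvature, nablaCurvature, eq_neg_of_add_eq_zero_left h, curvature_swap (nabla U X),
    curvature_swap X (nabla U Y), curvature_swap X Y]
  abel

theorem inner_nablaCurvature [T2Space M] {U X Y Z W : Π x : M, TangentSpace I x}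
    (hX : CMDiff ∞ (T% X)) (hY : CMDiff ∞ (T% Y)) (hZ : CMDiff ∞ (T% Z))
    (hW : CMDiff ∞ (T% W)) (x : M) :
    inner ℝ (nablaCurvature U X Y Z x) (W x) =
      d% (fun y ↦ (inner ℝ (curvature X Y Z y) (W y) : ℝ)) x (U x)
        - inner ℝ (curvature (nabla U X) Y Z x) (W x) - inner ℝ (curvature X (nabla U Y) Z x) (W x)
        - inner ℝ (curvature X Y (nabla U Z) x) (W x)
        - inner ℝ (curvature X Y Z x) (nabla U W x) := by
  rw [mvfderiv_inner U (contMDiff_curvature hX hY hZ) hW]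
  simp only [nablaCurvature, Pi.sub_apply, inner_sub_left]
  ring

theorem inner_nablaCurvature_skew [T2Space M] {U X Y Z W : Π x : M, TangentSpace I x}
    (hU : CMDiff ∞ (T% U)) (hX : CMDiff ∞ (T% X)) (hY : CMDiff ∞ (T% Y)) (hZ : CMDiff ∞ (T% Z))
    (hW : CMDiff ∞ (T% W)) (x : M) :
    inner ℝ (nablaCurvature U X Y Z x) (W x) =
      -(inner ℝ (nablaCurvature U X Y W x) (Z x) : ℝ) := by
  have hUX := contMDiff_nabla hU hX
  have hUY := contMDiff_nabla hU hY
  have hUZ := contMDiff_nabla hU hZ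
  have hUW := contMDiff_nabla hU hW
  rw [inner_nablaCurvature hX hY hZ hW, inner_nablaCurvature hX hY hW hZ,
    funext (inner_curvature_skew hX hY hZ hW), mvfderiv_fun_neg, neg_apply,
    inner_curvature_skew hUX hY hZ hW, inner_curvature_skew hX hUY hZ hW,
    inner_curvature_skew hX hY hUZ hW, inner_curvature_skew hX hY hZ hUW]
  ring

/-- The second Bianchi identity. -/
theorem nablaCurvature_bianchi [T2Space M] {X Y Z W : Π x : M, TangentSpace I x}
    (hX : CMDiff ∞ (T% X)) (hY : CMDiff ∞ (T% Y)) (hZ : CMDiff ∞ (T% Z)) (hW : CMDiff ∞ (T% W)) :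
    nablaCurvature X Y Z W + nablaCurvature Y Z X W + nablaCurvature Z X Y W = 0 := by
  -- the terms of the cyclic sum in which the first or second slot is differentiated
  have slots {A B C : Π x : M, TangentSpace I x} (hA : CMDiff ∞ (T% A)) (hB : CMDiff ∞ (T% B)) :
      curvature (nabla A B) C W + curvature C (nabla B A) W =
        nabla (mlieBracket I A B) (nabla C W) - nabla C (nabla (mlieBracket I A B) W)
          - nabla (mlieBracket I (mlieBracket I A B) C) W := by
    rw [curvature_swap C, ← sub_eq_add_neg,
      ← curvature_sub_left (contMDiff_nabla hA hB) (contMDiff_nabla hB hA) hW,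
      nabla_sub_nabla hA hB]
    rfl
  have first {A B C : Π x : M, TangentSpace I x} (hA : CMDiff ∞ (T% A)) (hB : CMDiff ∞ (T% B))
      (hC : CMDiff ∞ (T% C)) : nabla A (curvature B C W) =
        nabla A (nabla B (nabla C W)) - nabla A (nabla C (nabla B W))
          - nabla A (nabla (mlieBracket I B C) W) := by
    have h1 := contMDiff_nabla hB (contMDiff_nabla hC hW)
    have h2 := contMDiff_nabla hC (contMDiff_nabla hB hW)
    rw [curvature_eq, nabla_sub_right A (h1.sub_section h2)
      (contMDiff_nabla (contMDiff_mlieBracket hB hC) hW), nabla_sub_right A h1 h2]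
  have jac : nabla (mlieBracket I (mlieBracket I X Y) Z) W
      + nabla (mlieBracket I (mlieBracket I Y Z) X) W
      + nabla (mlieBracket I (mlieBracket I Z X) Y) W = 0 := by
    rw [← nabla_add_left, ← nabla_add_left]
    have j := mlieBracket_jacobi hX hY hZ
    have s1 : mlieBracket I (mlieBracket I Y Z) X = -mlieBracket I X (mlieBracket I Y Z) :=
      mlieBracket_swap
    have s2 : mlieBracket I (mlieBracket I Z X) Y = -mlieBracket I Y (mlieBracket I Z X) :=
      mlieBracket_swap
    have s3 : mlieBracket I Z X = -mlieBracket I X Z := mlieBracket_swap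
    have s4 : mlieBracket I Y (-mlieBracket I X Z) = -mlieBracket I Y (mlieBracket I X Z) := by
      have : CompleteSpace E := FiniteDimensional.complete ℝ E
      ext y
      have := mlieBracket_const_smul_right (c := (-1 : ℝ)) (V := Y)
        (mdiffAt_field (contMDiff_mlieBracket hX hZ) y)
      simpa using this
    rw [s1, s2, s3, s4, j]
    ext y
    simp [nabla]
  simp only [nablaCurvature, first hX hY hZ, first hY hZ hX, first hZ hX hY]
  have a := slots (C := Z) hX hY
  have b := slots (C := X) hY hZ
  have c := slots (C := Y) hZ hX
  rw [← eq_sub_iff_add_eq] at a b c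
  rw [a, b, c, curvature_eq Y Z (nabla X W), curvature_eq Z X (nabla Y W),
    curvature_eq X Y (nabla Z W), ← jac]
  abel

/-- The covariant derivative `(∇_U Ric)(V, W)` of the Ricci tensor, on vector fields. -/
def nablaRicci (U V W : Π x : M, TangentSpace I x) (x : M) : ℝ :=
  d% (fun y ↦ ricci y (V y) (W y)) x (U x) - ricci x (nabla U V x) (W x)
    - ricci x (V x) (nabla U W x)

/-- If the vectors `c i` express an infinitesimal rotation of the orthonormal basis `b`, then the
first-order variation of the trace of an endomorphism vanishes. -/
theorem sum_inner_rotation_eq_zero {V ι : Type*} [NormedAddCommGroup V] [InnerProductSpace ℝ V]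
    [Fintype ι] (b : OrthonormalBasis ι ℝ V) (A : V →ₗ[ℝ] V) {c : ι → V}
    (hc : ∀ i j, inner ℝ (c i) (b j) + inner ℝ (b i) (c j) = (0 : ℝ)) :
    ∑ i, (inner ℝ (A (c i)) (b i) + inner ℝ (A (b i)) (c i) : ℝ) = 0 := by
  have h1 (i) : (inner ℝ (A (c i)) (b i) : ℝ) =
      ∑ j, inner ℝ (b j) (c i) * inner ℝ (A (b j)) (b i) := by
    conv_lhs => rw [← b.sum_repr' (c i), map_sum, sum_inner]
    simp [inner_smul_left]
  have h2 (i) : (inner ℝ (A (b i)) (c i) : ℝ) =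
      ∑ j, inner ℝ (b j) (c i) * inner ℝ (A (b i)) (b j) := by
    conv_lhs => rw [← b.sum_repr' (c i), inner_sum]
    simp [inner_smul_right]
  simp only [h1, h2, Finset.sum_add_distrib]
  rw [Finset.sum_comm, ← Finset.sum_add_distrib]
  refine Finset.sum_eq_zero fun i _ ↦ ?_
  rw [← Finset.sum_add_distrib]
  refine Finset.sum_eq_zero fun j _ ↦ ?_
  rw [← add_mul, real_inner_comm (c i) (b j), add_comm, hc, zero_mul]

/-- Along an orthonormal frame the connection form is skew. -/
theorem inner_nabla_frame [T2Space M] {n : ℕ} {F : Fin n → Π x : M, TangentSpace I x}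
    (hF : ∀ i, CMDiff ∞ (T% (F i))) {x : M} (ho : ∀ᶠ y in 𝓝 x, Orthonormal ℝ (F · y))
    (U : Π x : M, TangentSpace I x) (i j : Fin n) :
    inner ℝ (nabla U (F i) x) (F j x) + inner ℝ (F i x) (nabla U (F j) x) = (0 : ℝ) := by
  rw [← mvfderiv_inner U (hF i) (hF j)]
  have h : (fun y ↦ (inner ℝ (F i y) (F j y) : ℝ)) =ᶠ[𝓝 x] fun _ ↦ if i = j then 1 else 0 := by
    filter_upwards [ho] with y hy
    exact orthonormal_iff_ite.1 hy i j
  rw [mvfderiv_congr h, mvfderiv_const, zero_apply]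

/-- Contraction commutes with covariant differentiation. The frame need not be parallel at `x`: its
derivatives are an infinitesimal rotation, which does not change a trace. -/
theorem nablaRicci_eq_sum [T2Space M] {F : Fin (Module.finrank ℝ E) → Π x : M, TangentSpace I x}
    (hF : ∀ i, CMDiff ∞ (T% (F i))) {x : M} (ho : ∀ᶠ y in 𝓝 x, Orthonormal ℝ (F · y))
    {U V W : Π x : M, TangentSpace I x} (hU : CMDiff ∞ (T% U)) (hV : CMDiff ∞ (T% V))
    (hW : CMDiff ∞ (T% W)) :
    nablaRicci U V W x = ∑ i, inner ℝ (nablaCurvature U (F i) V W x) (F i x) := by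
  have hUV := contMDiff_nabla hU hV
  have hUW := contMDiff_nabla hU hW
  have ho' := ho.self_of_nhds
  have h1 : (fun y ↦ ricci y (V y) (W y)) =ᶠ[𝓝 x]
      fun y ↦ ∑ i, inner ℝ (curvature (F i) V W y) (F i y) := by
    filter_upwards [ho] with y hy
    exact ricci_eq_sum_frame hF hV hW hy
  have h2 : d% (fun y ↦ ricci y (V y) (W y)) x (U x) =
      ∑ i, d% (fun y ↦ (inner ℝ (curvature (F i) V W y) (F i y) : ℝ)) x (U x) := by
    rw [mvfderiv_congr h1, mvfderiv_fun_sum fun i ↦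
      contMDiff_inner (contMDiff_curvature (hF i) hV hW) (hF i)]
  have h3 := sum_inner_rotation_eq_zero (orthonormalBasisOfFrame ho') (riemannHom (V x) (W x))
    (c := fun i ↦ nabla U (F i) x) (by simpa using inner_nabla_frame hF ho U)
  simp only [orthonormalBasisOfFrame_apply, riemannHom_apply, riemann_apply (hF _) hV hW,
    riemann_apply (contMDiff_nabla hU (hF _)) hV hW] at h3
  rw [nablaRicci, h2, ricci_eq_sum_frame hF hUV hW ho', ricci_eq_sum_frame hF hV hUW ho',
    ← sub_zero (_ - _), ← h3, ← Finset.sum_sub_distrib, ← Finset.sum_sub_distrib,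
    ← Finset.sum_sub_distrib]
  refine Finset.sum_congr rfl fun i _ ↦ ?_
  rw [inner_nablaCurvature (hF i) hV hW (hF i)]
  ring

/-- The contracted second Bianchi identity `d R = 2 div Ric`. -/
theorem sum_nablaRicci [T2Space M] {F : Fin (Module.finrank ℝ E) → Π x : M, TangentSpace I x}
    (hF : ∀ i, CMDiff ∞ (T% (F i))) {x : M} (ho : ∀ᶠ y in 𝓝 x, Orthonormal ℝ (F · y))
    {W : Π x : M, TangentSpace I x} (hW : CMDiff ∞ (T% W)) :
    ∑ i, nablaRicci W (F i) (F i) x = 2 * ∑ i, nablaRicci (F i) W (F i) x := by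
  have h (i j) : (inner ℝ (nablaCurvature W (F j) (F i) (F i) x) (F j x) : ℝ) =
      inner ℝ (nablaCurvature (F j) (F i) W (F j) x) (F i x)
        + inner ℝ (nablaCurvature (F i) (F j) W (F i) x) (F j x) := by
    have b := congrArg (fun A ↦ (inner ℝ (A x) (F j x) : ℝ))
      (nablaCurvature_bianchi hW (hF j) (hF i) (hF i))
    simp only [Pi.add_apply, inner_add_left, Pi.zero_apply, inner_zero_left] at b
    rw [inner_nablaCurvature_skew (hF j) (hF i) hW (hF i) (hF j),
      nablaCurvature_swap hW (hF j) (hF i), Pi.neg_apply, inner_neg_left] at b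
    linarith
  simp only [nablaRicci_eq_sum hF ho hW (hF _) (hF _), nablaRicci_eq_sum hF ho (hF _) hW (hF _), h,
    Finset.sum_add_distrib]
  rw [Finset.sum_comm]
  ring

/-! ### The soliton equation -/

/-- The second covariant derivative `∇²_{U, V} X` of a vector field `X`. -/
def nablaSq (U V X : Π x : M, TangentSpace I x) : Π x : M, TangentSpace I x :=
  nabla U (nabla V X) - nabla (nabla U V) X

/-- The Ricci identity. -/
theorem nablaSq_sub_nablaSq {U V X : Π x : M, TangentSpace I x} (hU : CMDiff ∞ (T% U))
    (hV : CMDiff ∞ (T% V)) : nablaSq U V X - nablaSq V U X = curvature U V X := by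
  rw [nablaSq, nablaSq, curvature_eq, ← nabla_sub_nabla hU hV, nabla_sub_left]
  abel

theorem lieMetric_apply {X V W : Π x : M, TangentSpace I x}
    (hX : CMDiff ∞ (T% X)) (x : M) :
    lieMetric X x (V x) (W x) =
      inner ℝ (nabla V X x) (W x) + inner ℝ (V x) (nabla W X x) := by
  have hv := mdifferentiableAt_extend I E (V := fun x : M ↦ TangentSpace I x) (V x)
  have hw := mdifferentiableAt_extend I E (V := fun x : M ↦ TangentSpace I x) (W x)
  have hx := mdiffAt_field hX x
  rw [lieMetric, lieMetricField, leviCivita_metric hx hv hw, ← leviCivita_torsion hx hv,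
    ← leviCivita_torsion hx hw, inner_sub_left, inner_sub_right]
  simp [nabla]

/-- Differentiating the soliton equation `Ric + ½ ℒ_X g = λ g`. -/
theorem IsRicciSoliton.nablaRicci_eq [T2Space M] {X : Π x : M, TangentSpace I x} {lam : ℝ}
    (h : IsRicciSoliton X lam) {V W : Π x : M, TangentSpace I x}
    (U : Π x : M, TangentSpace I x) (hV : CMDiff ∞ (T% V)) (hW : CMDiff ∞ (T% W)) (x : M) :
    nablaRicci U V W x =
      -(1 / 2) * (inner ℝ (nablaSq U V X x) (W x) + inner ℝ (V x) (nablaSq U W X x)) := by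
  have hX := h.smooth
  have e (A B : Π x : M, TangentSpace I x) (y : M) : ricci y (A y) (B y) =
      lam * inner ℝ (A y) (B y)
        + -(1 / 2) * (inner ℝ (nabla A X y) (B y) + inner ℝ (A y) (nabla B X y)) := by
    rw [← lieMetric_apply hX, ← h.soliton]
    ring
  have hVX := contMDiff_nabla hV hX
  have hWX := contMDiff_nabla hW hX
  have d : d% (fun y ↦ ricci y (V y) (W y)) x (U x) =
      lam * (inner ℝ (nabla U V x) (W x) + inner ℝ (V x) (nabla U W x))
        + -(1 / 2) * (inner ℝ (nabla U (nabla V X) x) (W x) + inner ℝ (nabla V X x) (nabla U W x)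
          + (inner ℝ (nabla U V x) (nabla W X x) + inner ℝ (V x) (nabla U (nabla W X) x))) := by
    have c1 : CMDiff ∞ (fun y ↦ (inner ℝ (nabla V X y) (W y) + inner ℝ (V y) (nabla W X y) : ℝ)) :=
      (contMDiff_inner hVX hW).add (contMDiff_inner hV hWX)
    have c2 : CMDiff ∞ (fun y ↦ lam * (inner ℝ (V y) (W y) : ℝ)) :=
      contMDiff_const.mul (contMDiff_inner hV hW)
    have c3 : CMDiff ∞ (fun y ↦ -(1 / 2) *
        (inner ℝ (nabla V X y) (W y) + inner ℝ (V y) (nabla W X y) : ℝ)) := contMDiff_const.mul c1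
    rw [funext (e V W), mvfderiv_fun_add (mdiffAt_fun c2 x) (mdiffAt_fun c3 x), add_apply,
      mvfderiv_fun_const_mul (contMDiff_inner hV hW), mvfderiv_fun_const_mul c1,
      mvfderiv_fun_add (mdiffAt_fun (contMDiff_inner hVX hW) x)
      (mdiffAt_fun (contMDiff_inner hV hWX) x), add_apply, mvfderiv_inner U hV hW,
      mvfderiv_inner U hVX hW, mvfderiv_inner U hV hWX]
  rw [nablaRicci, d, e (nabla U V) W, e V (nabla U W)]
  simp only [nablaSq, Pi.sub_apply, inner_sub_left, inner_sub_right]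
  ring

/-- On a Ricci soliton the rough Laplacian of the field is `Δ X = -Ric(X, ·)`. -/
theorem IsRicciSoliton.sum_inner_nablaSq [T2Space M] {X : Π x : M, TangentSpace I x} {lam : ℝ}
    (h : IsRicciSoliton X lam) {F : Fin (Module.finrank ℝ E) → Π x : M, TangentSpace I x}
    (hF : ∀ i, CMDiff ∞ (T% (F i))) {x : M} (ho : ∀ᶠ y in 𝓝 x, Orthonormal ℝ (F · y))
    {W : Π x : M, TangentSpace I x} (hW : CMDiff ∞ (T% W)) :
    ∑ i, inner ℝ (nablaSq (F i) (F i) X x) (W x) = -ricci x (W x) (X x) := by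
  have b := sum_nablaRicci hF ho hW
  simp only [h.nablaRicci_eq _ (hF _) (hF _), h.nablaRicci_eq _ hW (hF _)] at b
  rw [ricci_eq_sum_frame hF hW h.smooth ho.self_of_nhds]
  simp only [← nablaSq_sub_nablaSq (hF _) hW, Pi.sub_apply, inner_sub_left,
    Finset.sum_sub_distrib]
  simp only [real_inner_comm (F _ x), ← Finset.mul_sum, Finset.sum_add_distrib] at b ⊢
  simp only [real_inner_comm (W x)] at b ⊢
  linarith

/-! ### The Bochner formula -/

theorem laplacian_eq_sum [T2Space M] {F : Fin (Module.finrank ℝ E) → Π x : M, TangentSpace I x}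
    (hF : ∀ i, CMDiff ∞ (T% (F i))) {x : M} (ho : Orthonormal ℝ (F · x)) {u : M → ℝ}
    (hu : CMDiff ∞ u) :
    laplacian I u x = ∑ i, (d% (fun y ↦ d% u y (F i y)) x (F i x)
      - d% u x (nabla (F i) (F i) x)) := by
  have : FiniteDimensional ℝ (TangentSpace I x) := inferInstanceAs (FiniteDimensional ℝ E)
  rw [laplacian, divergence, LinearMap.trace_eq_sum_inner _ (orthonormalBasisOfFrame ho)]
  refine Finset.sum_congr rfl fun i _ ↦ ?_
  have h1 := mvfderiv_inner (F i) (contMDiff_grad hu) (hF i) x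
  simp only [inner_grad] at h1
  rw [h1, orthonormalBasisOfFrame_apply, real_inner_comm]
  simp [nabla]

theorem covDerivNormSq_eq_sum {X : Π x : M, TangentSpace I x}
    {F : Fin (Module.finrank ℝ E) → Π x : M, TangentSpace I x} {x : M}
    (ho : Orthonormal ℝ (F · x)) : covDerivNormSq X x = ∑ i, ‖nabla (F i) X x‖ ^ 2 := by
  have : FiniteDimensional ℝ (TangentSpace I x) := inferInstanceAs (FiniteDimensional ℝ E)
  let A : TangentSpace I x →ₗ[ℝ] TangentSpace I x := leviCivita I M X x
  have h1 := LinearMap.trace_eq_sum_inner (A.adjoint ∘ₗ A) (orthonormalBasisOfFrame ho)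
  rw [LinearMap.trace_eq_sum_inner (A.adjoint ∘ₗ A) (stdOrthonormalBasis ℝ (TangentSpace I x))]
    at h1
  simpa [LinearMap.adjoint_inner_right, covDerivNormSq, nabla, A] using h1

/-- The Bochner formula `½ Δ |X|² = |∇X|² + g(Δ X, X)`. -/
theorem half_laplacian_norm_sq [T2Space M] {X : Π x : M, TangentSpace I x} (hX : CMDiff ∞ (T% X))
    {F : Fin (Module.finrank ℝ E) → Π x : M, TangentSpace I x} (hF : ∀ i, CMDiff ∞ (T% (F i)))
    {x : M} (ho : Orthonormal ℝ (F · x)) :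
    1 / 2 * laplacian I (fun y ↦ ‖X y‖ ^ 2) x =
      covDerivNormSq X x + ∑ i, inner ℝ (nablaSq (F i) (F i) X x) (X x) := by
  simp only [← real_inner_self_eq_norm_sq]
  rw [laplacian_eq_sum hF ho (contMDiff_inner hX hX), covDerivNormSq_eq_sum ho,
    ← Finset.sum_add_distrib, Finset.mul_sum]
  refine Finset.sum_congr rfl fun i _ ↦ ?_
  have hFX := contMDiff_nabla (hF i) hX
  rw [funext (mvfderiv_inner (F i) hX hX), mvfderiv_fun_add
    (mdiffAt_fun (contMDiff_inner hFX hX) x) (mdiffAt_fun (contMDiff_inner hX hFX) x), add_apply,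
    mvfderiv_inner _ hFX hX, mvfderiv_inner _ hX hFX, mvfderiv_inner (nabla (F i) (F i)) hX hX,
    ← real_inner_self_eq_norm_sq]
  simp only [nablaSq, Pi.sub_apply, inner_sub_right, real_inner_comm (X x)]
  ring

theorem IsRicciSoliton.half_laplacian_norm_sq [T2Space M] {X : Π x : M, TangentSpace I x} {lam : ℝ}
    (h : IsRicciSoliton X lam) (x : M) :
    1 / 2 * laplacian I (fun y ↦ ‖X y‖ ^ 2) x = covDerivNormSq X x - ricci x (X x) (X x) := by
  obtain ⟨F, hF, ho⟩ := exists_orthonormal_frame (I := I) x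
  rw [RicciSoliton.half_laplacian_norm_sq h.smooth hF ho.self_of_nhds,
    h.sum_inner_nablaSq hF ho h.smooth, sub_eq_add_neg]

theorem IsRicciSoliton.half_laplacianX_norm_sq [T2Space M] {X : Π x : M, TangentSpace I x}
    {lam : ℝ} (h : IsRicciSoliton X lam) (x : M) :
    1 / 2 * laplacianX X (fun y ↦ ‖X y‖ ^ 2) x = covDerivNormSq X x - lam * ‖X x‖ ^ 2 := by
  have h1 := h.half_laplacian_norm_sq x
  have h2 := h.soliton x (X x) (X x)
  have h3 := mvfderiv_inner X h.smooth h.smooth x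
  rw [lieMetric_apply h.smooth] at h2
  simp only [real_inner_self_eq_norm_sq] at h2 h3
  rw [laplacianX, real_inner_comm, inner_grad, mul_sub, h1, h3]
  linarith

end
end RicciSoliton

theorem proposition2p7 {m : ℕ} {M : Type*} [TopologicalSpace M] [T2Space M]
    [SecondCountableTopology M] [ChartedSpace (EuclideanSpace ℝ (Fin m)) M]
    [IsManifold (𝓡 m) ∞ M]
    [RiemannianBundle (fun x : M ↦ TangentSpace (𝓡 m) x)]
    [IsContMDiffRiemannianBundle (𝓡 m) ∞ (EuclideanSpace ℝ (Fin m))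
      (fun x : M ↦ TangentSpace (𝓡 m) x)]
    (X : Π x : M, TangentSpace (𝓡 m) x) (lam : ℝ)
    (h : RicciSoliton.IsRicciSoliton X lam) :
    (∀ x : M, 1 / 2 * RicciSoliton.laplacian (𝓡 m) (fun y : M ↦ ‖X y‖ ^ 2) x =
      RicciSoliton.covDerivNormSq X x - RicciSoliton.ricci x (X x) (X x)) ∧
    (∀ x : M, 1 / 2 * RicciSoliton.laplacianX X (fun y : M ↦ ‖X y‖ ^ 2) x =
      RicciSoliton.covDerivNormSq X x - lam * ‖X x‖ ^ 2) :=
  ⟨h.half_laplacian_norm_sq, h.half_laplacianX_norm_sq⟩
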